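/- Normalise the Fourier transform by $\hat g(z)=(\mathcal F g)(z)=\frac1{\sqrt{2\pi}}\int_{\mathbb R} e^{-izs}g(s)\,ds$, and for $t>0$ let $\mathrm{PW}_t=\mathcal F L^2[-t,t]$ be the Paley--Wiener space of entire functions, with the norm $\|F\|=\|F\|_{L^2(\mathbb R)}$. A positive Borel measure $\mu$ on $\mathbb R$ is called PW-sampling if for every $t>0$ there is a constant $C>0$ such that $$C^{-1}\|F\|\le \|F\|_{L^2(\mu)}\le C\,\|F\|\qquad\text{for all }F\in \mathrm{PW}_t .$$ A positive Borel measure $\mu$ on $\mathbb R$ is called a GL-measure if (a) $\mu$ is $\Pi$-finite: $\int_{\mathbb R}\frac{d\mu(x)}{1+x^2}<\infty$; (b) $\mu$ is not discrete, i.e. its (closed) support has an accumulation point in $\mathbb R$; and (c) there are a constant $C>0$ and a function $f:\mathbb R\to\mathbb C$ in $L^1_{\rm loc}(\mathbb R)$ such that $\mathcal F\mu=C\delta_0+f$ in the sense of distributions, i.e. $\int\hat\varphi\,d\mu=C\varphi(0)+\int f\varphi\,dx$ for all $\varphi\in C_c^\infty(\mathbb R;\mathbb C)$. Then every GL-measure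 is PW-sampling. -/

import Mathlib

open MeasureTheory Set Filter Topology
open scoped ENNReal ContDiff

noncomputable section

/-- The Fourier transform `(𝓕 g)(z) = (2π)^(-1/2) ∫ exp(-i z s) g(s) ds`, evaluated at a complex
point `z` (meaningful for every `z` when `g` is integrable with compact support). -/
def fourierT (g : ℝ → ℂ) (z : ℂ) : ℂ :=
  ((Real.sqrt (2 * Real.pi))⁻¹ : ℝ) * ∫ s : ℝ, Complex.exp (-Complex.I * z * (s : ℂ)) * g s

/-- The Paley-Wiener space `PW_t = 𝓕 L²[-t, t]`, a space of entire functions. -/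
def PaleyWiener (t : ℝ) : Set (ℂ → ℂ) :=
  {F | ∃ g : ℝ → ℂ, MemLp g 2 volume ∧ Function.support g ⊆ Icc (-t) t ∧ ∀ z, F z = fourierT g z}

/-- The norm of the restriction of `F` to the real line in `L²(μ)`, with values in `[0, ∞]`. For
`μ = volume` and `F` in a Paley-Wiener space, this is the norm of that space. -/
def normL2 (μ : Measure ℝ) (F : ℂ → ℂ) : ℝ≥0∞ :=
  eLpNorm (fun x : ℝ => F (x : ℂ)) 2 μ

/-- `μ` is sampling for every Paley-Wiener space `PW_t`, `t > 0`: the norms of `PW_t` and of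
`L²(μ)` are equivalent on `PW_t`, with a constant that may depend on `t`. -/
def IsPWSampling (μ : Measure ℝ) : Prop :=
  ∀ t : ℝ, 0 < t → ∃ C : ℝ, 0 < C ∧ ∀ F ∈ PaleyWiener t,
    ENNReal.ofReal C⁻¹ * normL2 volume F ≤ normL2 μ F ∧
      normL2 μ F ≤ ENNReal.ofReal C * normL2 volume F

/-- Poisson-finite: `∫ dμ(x) / (1 + x²) < ∞`. -/
def IsPoissonFinite (μ : Measure ℝ) : Prop :=
  ∫⁻ x : ℝ, ENNReal.ofReal (1 / (1 + x ^ 2)) ∂μ < ⊤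

/-- The (closed) support of `μ` has no finite accumulation point. -/
def IsDiscreteMeasure (μ : Measure ℝ) : Prop :=
  ∀ x : ℝ, ¬ AccPt x (𝓟 μ.support)

/-- The distributional identity `𝓕 μ = C δ₀ + f`, that is, `⟨μ, 𝓕 φ⟩ = C φ(0) + ∫ f φ` for all
test functions `φ`. -/
def FourierEqDeltaAdd (μ : Measure ℝ) (C : ℝ) (f : ℝ → ℂ) : Prop :=
  ∀ φ : ℝ → ℂ, ContDiff ℝ ∞ φ → HasCompactSupport φ →
    ∫ x : ℝ, fourierT φ (x : ℂ) ∂μ = (C : ℂ) * φ 0 + ∫ x : ℝ, f x * φ x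

/-- Gelfand-Levitan measures. -/
structure IsGLMeasure (μ : Measure ℝ) : Prop where
  poissonFinite : IsPoissonFinite μ
  not_discrete : ¬ IsDiscreteMeasure μ
  fourier_eq : ∃ C : ℝ, 0 < C ∧ ∃ f : ℝ → ℂ, LocallyIntegrable f volume ∧ FourierEqDeltaAdd μ C f

end

open scoped FourierTransform ComplexConjugate Convolution

/-! Let F = ĝ with g in L²[-t, t]. The autocorrelation A of g has transform √(2π)|ĝ|², and A(0) =
‖g‖², so testing 𝓕μ = Cδ₀ + f on A gives √(2π)‖ĝ‖²_{L²(μ)} = C‖g‖² + ∫ f A for smooth g. Since |A| ≤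
‖g‖² and A lives on a bounded interval where f is integrable, the upper bound is immediate
(`FourierEqDeltaAdd.normL2_le`).

For the lower bound, ∫ f A is a compact perturbation of C‖g‖². Replace f by a trigonometric
polynomial p with L¹ error at most C/2: the error costs at most half of C‖g‖², and ∫ p A is a
combination of finitely many values |ĝ(l)|². Hence g ↦ ĝ in L²(μ) is bounded below up to a
finite-rank term (`FourierEqDeltaAdd.le_normL2_add_sum`). Such an operator is bounded below once it
is injective (`ContinuousLinearMap.exists_le_norm_of_finiteDimensional`), and injectivity is the
identity theorem at an accumulation point of the support (`eq_zero_of_normL2_eq_zero`).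

Plancherel is not invoked: Lebesgue measure satisfies the same identity with f = 0, so the same
estimates compare ‖g‖ with ‖ĝ‖, up to constants that do no harm. -/

theorem fourierT_ofReal (g : ℝ → ℂ) (x : ℝ) :
    fourierT g (x : ℂ) = ((Real.sqrt (2 * Real.pi))⁻¹ : ℝ) * 𝓕 g (x / (2 * Real.pi)) := by
  rw [fourierT, Real.fourier_real_eq_integral_exp_smul]
  congr 1
  refine integral_congr_ae (Eventually.of_forall fun s => ?_)
  simp only [smul_eq_mul]
  congr 2
  have : (Real.pi : ℂ) ≠ 0 := by exact_mod_cast Real.pi_ne_zero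
  push_cast
  field_simp

/-! ### Autocorrelations and their transforms -/

/-- The reflected conjugate `s ↦ conj (g (-s))`. -/
noncomputable def conjReflect (g : ℝ → ℂ) (s : ℝ) : ℂ := conj (g (-s))

/-- The autocorrelation `x ↦ ∫ g(s) conj (g (s - x)) ds`. -/
noncomputable def autocorr (g : ℝ → ℂ) : ℝ → ℂ :=
  g ⋆[ContinuousLinearMap.mul ℂ ℂ] conjReflect g

theorem autocorr_apply (g : ℝ → ℂ) (x : ℝ) :
    autocorr g x = ∫ s, g s * conj (g (s - x)) := by
  simp [autocorr, convolution, conjReflect]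

theorem fourier_conjReflect (g : ℝ → ℂ) (w : ℝ) : 𝓕 (conjReflect g) w = conj (𝓕 g w) := by
  rw [Real.fourier_real_eq_integral_exp_smul, Real.fourier_real_eq_integral_exp_smul,
    ← integral_conj, ← integral_neg_eq_self]
  refine integral_congr_ae (Eventually.of_forall fun s => ?_)
  simp [conjReflect, ← Complex.exp_conj, map_ofNat]

theorem HasCompactSupport.conjReflect {g : ℝ → ℂ} (hg : HasCompactSupport g) :
    HasCompactSupport (conjReflect g) := by
  have h : HasCompactSupport (fun s => g (-s)) := hg.comp_homeomorph (Homeomorph.neg ℝ)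
  exact h.comp_left (g := fun z : ℂ => conj z) (by simp)

theorem ContDiff.conjReflect {g : ℝ → ℂ} (hg : ContDiff ℝ ∞ g) : ContDiff ℝ ∞ (conjReflect g) :=
  Complex.conjCLE.contDiff.comp (hg.comp contDiff_neg)

theorem contDiff_autocorr {g : ℝ → ℂ} (hg : ContDiff ℝ ∞ g) (hc : HasCompactSupport g) :
    ContDiff ℝ ∞ (autocorr g) := by
  -- The same convolution with the product taken as ℝ-bilinear, since smoothness is over ℝ.
  change ContDiff ℝ ∞ (g ⋆[ContinuousLinearMap.mul ℝ ℂ] conjReflect g)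
  exact HasCompactSupport.contDiff_convolution_right (n := ⊤) _ hc.conjReflect
    hg.continuous.locallyIntegrable hg.conjReflect

theorem hasCompactSupport_autocorr {g : ℝ → ℂ} (hc : HasCompactSupport g) :
    HasCompactSupport (autocorr g) :=
  hc.convolution _ hc.conjReflect

theorem autocorr_zero (g : ℝ → ℂ) : autocorr g 0 = ((∫ s, ‖g s‖ ^ 2 : ℝ) : ℂ) := by
  rw [autocorr_apply, ← integral_complex_ofReal]
  simp [Complex.mul_conj, Complex.normSq_eq_norm_sq]

/-- The inequality 2ab ≤ a² + b² under the integral, followed by translation invariance. -/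
theorem norm_autocorr_le {g : ℝ → ℂ} (hg : MemLp g 2) (x : ℝ) :
    ‖autocorr g x‖ ≤ ∫ s, ‖g s‖ ^ 2 := by
  have hi : Integrable (fun s => ‖g s‖ ^ 2) := hg.integrable_norm_pow (by norm_num)
  rw [autocorr_apply]
  refine (norm_integral_le_of_norm_le (g := fun s => (‖g s‖ ^ 2 + ‖g (s - x)‖ ^ 2) / 2)
    ((hi.add (hi.comp_sub_right x)).div_const 2) (Eventually.of_forall fun s => ?_)).trans ?_
  · rw [norm_mul, RCLike.norm_conj]
    nlinarith [sq_nonneg (‖g s‖ - ‖g (s - x)‖)]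
  · rw [integral_div, integral_add hi (hi.comp_sub_right x),
      integral_sub_right_eq_self (fun s => ‖g s‖ ^ 2)]
    linarith

theorem support_autocorr_subset {g : ℝ → ℂ} {T : ℝ} (h : Function.support g ⊆ Icc (-T) T) :
    Function.support (autocorr g) ⊆ Icc (-(2 * T)) (2 * T) := by
  intro x hx
  by_contra hxT
  refine hx ?_
  rw [autocorr_apply]
  refine integral_eq_zero_of_ae (Eventually.of_forall fun s => ?_)
  by_contra hne
  have h1 := h (left_ne_zero_of_mul hne)
  have h2 := h ((map_ne_zero _).1 (right_ne_zero_of_mul hne))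
  simp only [mem_Icc] at h1 h2 hxT
  exact hxT ⟨by linarith, by linarith⟩

theorem fourierT_autocorr {g : ℝ → ℂ} (hg : Integrable g) (x : ℝ) :
    fourierT (autocorr g) x = ((Real.sqrt (2 * Real.pi) * ‖fourierT g x‖ ^ 2 : ℝ) : ℂ) := by
  have hr : Integrable (conjReflect g) :=
    Complex.conjCLE.toContinuousLinearMap.integrable_comp hg.comp_neg
  have hpos : 0 < Real.sqrt (2 * Real.pi) := by positivity
  rw [fourierT_ofReal, fourierT_ofReal, autocorr, Real.fourier_mul_convolution_eq hg hr,
    fourier_conjReflect, Complex.mul_conj, Complex.normSq_eq_norm_sq, norm_mul]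
  rw [Complex.norm_real, Real.norm_of_nonneg (by positivity)]
  rw [← Complex.ofReal_mul]
  congr 1
  field_simp

/-- The transform of a test function is Schwartz, so (1 + x²)|ĝ(x)|² is bounded and
Poisson-finiteness applies. Without integrability the Bochner integral of |ĝ|² would not represent
the squared norm. -/
theorem integrable_norm_sq_fourierT {μ : Measure ℝ} (hμ : IsPoissonFinite μ) {g : ℝ → ℂ}
    (hg : ContDiff ℝ ∞ g) (hc : HasCompactSupport g) :
    Integrable (fun x : ℝ => ‖fourierT g x‖ ^ 2) μ := by
  have hw : Integrable (fun x : ℝ => 1 / (1 + x ^ 2)) μ := by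
    refine ⟨(by fun_prop : Measurable _).aestronglyMeasurable, ?_⟩
    rw [hasFiniteIntegral_iff_ofReal (Eventually.of_forall fun x => by positivity)]
    exact hμ
  set S : SchwartzMap ℝ ℂ := 𝓕 (hc.toSchwartzMap hg) with hS
  have hSg : ∀ w, S w = 𝓕 g w := fun w => by
    rw [hS, SchwartzMap.fourier_coe]; rfl
  obtain ⟨A, hA, hA'⟩ := S.decay 0 0
  obtain ⟨B, hB, hB'⟩ := S.decay 1 0
  have hfun : (fun x : ℝ => ‖fourierT g x‖ ^ 2) =
      fun x : ℝ => (2 * Real.pi)⁻¹ * ‖S (x / (2 * Real.pi))‖ ^ 2 := by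
    ext x
    rw [fourierT_ofReal, norm_mul, hSg, mul_pow, Complex.norm_real, Real.norm_of_nonneg (by positivity),
      inv_pow, Real.sq_sqrt (by positivity)]
  rw [hfun]
  refine ((hw.const_mul (A ^ 2 + (2 * Real.pi * B) ^ 2)).mono' ?_ ?_).const_mul _
  · exact Continuous.aestronglyMeasurable (by have := S.continuous; fun_prop)
  · refine Eventually.of_forall fun x => ?_
    have h1 := hA' (x / (2 * Real.pi))
    have h2 := hB' (x / (2 * Real.pi))
    simp only [norm_iteratedFDeriv_zero, pow_zero, one_mul, pow_one, Real.norm_eq_abs, abs_div,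
      abs_of_pos Real.two_pi_pos] at h1 h2
    set y := ‖S (x / (2 * Real.pi))‖
    have hy : 0 ≤ y := norm_nonneg _
    rw [Real.norm_of_nonneg (by positivity), mul_one_div, le_div_iff₀ (by positivity)]
    have h3 : |x| * y ≤ 2 * Real.pi * B := by
      rw [div_mul_eq_mul_div, div_le_iff₀ (by positivity)] at h2
      linarith
    have h4 : (|x| * y) ^ 2 ≤ (2 * Real.pi * B) ^ 2 := by gcongr
    have h5 : y ^ 2 ≤ A ^ 2 := by gcongr
    rw [mul_pow, sq_abs] at h4
    linarith

/-! ### The quadratic form of μ -/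

/-- The quadratic form identity `√(2π) ‖𝓕 g‖²_{L²(μ)} = C ‖g‖² + ∫ f (g ⋆ g̃)`. -/
theorem FourierEqDeltaAdd.integral_norm_sq {μ : Measure ℝ} {C : ℝ} {f : ℝ → ℂ}
    (h : FourierEqDeltaAdd μ C f) {g : ℝ → ℂ} (hg : ContDiff ℝ ∞ g) (hc : HasCompactSupport g) :
    ((Real.sqrt (2 * Real.pi) * ∫ x : ℝ, ‖fourierT g x‖ ^ 2 ∂μ : ℝ) : ℂ) =
      ((C * ∫ s, ‖g s‖ ^ 2 : ℝ) : ℂ) + ∫ x, f x * autocorr g x := by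
  have := h _ (contDiff_autocorr hg hc) (hasCompactSupport_autocorr hc)
  rw [autocorr_zero] at this
  simp_rw [fourierT_autocorr (hg.continuous.integrable_of_hasCompactSupport hc)] at this
  rw [integral_complex_ofReal, integral_const_mul] at this
  rw [this]
  push_cast
  rfl

theorem integrable_mul_autocorr {f g : ℝ → ℂ} (hf : LocallyIntegrable f)
    (hg : ContDiff ℝ ∞ g) (hc : HasCompactSupport g) :
    Integrable (fun x => f x * autocorr g x) := by
  simpa [mul_comm] using hf.integrable_smul_left_of_hasCompactSupport
    (contDiff_autocorr hg hc).continuous (hasCompactSupport_autocorr hc)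

/-- An L¹–L^∞ bound, used for f itself in the upper estimate and for f minus a trigonometric
polynomial in the lower one. -/
theorem norm_integral_mul_autocorr_le {f g : ℝ → ℂ} {T : ℝ} (hf : LocallyIntegrable f)
    (hg : ContDiff ℝ ∞ g) (hc : HasCompactSupport g) (hT : Function.support g ⊆ Icc (-T) T) :
    ‖∫ x, f x * autocorr g x‖ ≤
      (∫ x in Icc (-(2 * T)) (2 * T), ‖f x‖) * ∫ s, ‖g s‖ ^ 2 := by
  have h0 : ∫ x, f x * autocorr g x = ∫ x in Icc (-(2 * T)) (2 * T), f x * autocorr g x := by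
    refine (setIntegral_eq_integral_of_forall_compl_eq_zero fun x hx => ?_).symm
    have : autocorr g x = 0 := by
      by_contra hne
      exact hx (support_autocorr_subset hT hne)
    simp [this]
  rw [h0, ← integral_mul_const]
  refine norm_integral_le_of_norm_le
    (((hf.integrableOn_isCompact isCompact_Icc).norm).mul_const _)
    (Eventually.of_forall fun x => ?_)
  rw [norm_mul]
  gcongr
  exact norm_autocorr_le (hg.continuous.memLp_of_hasCompactSupport hc) x

/-- Testing the autocorrelation against a character gives a squared value of the transform. -/
theorem integral_exp_mul_autocorr {g : ℝ → ℂ} (hg : Integrable g) (l : ℝ) :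
    ∫ x : ℝ, Complex.exp (-Complex.I * l * x) * autocorr g x =
      ((2 * Real.pi * ‖fourierT g l‖ ^ 2 : ℝ) : ℂ) := by
  have h := fourierT_autocorr hg l
  have hpos : 0 < Real.sqrt (2 * Real.pi) := by positivity
  have hne : ((Real.sqrt (2 * Real.pi) : ℝ) : ℂ) ≠ 0 := by exact_mod_cast hpos.ne'
  rw [fourierT, Complex.ofReal_inv, inv_mul_eq_iff_eq_mul₀ hne] at h
  rw [h, ← Complex.ofReal_mul, ← mul_assoc, Real.mul_self_sqrt (by positivity)]

/-! ### Trigonometric approximation in L¹ -/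

/-- Trigonometric polynomials are dense in `L¹` of a bounded interval. -/
theorem exists_trigPoly_integral_norm_sub_le {f : ℝ → ℂ} (hf : LocallyIntegrable f) (R : ℝ)
    {ε : ℝ} (hε : 0 < ε) :
    ∃ (s : Finset ℤ) (c : ℤ → ℂ) (l : ℤ → ℝ),
      ∫ x in Icc (-R) R, ‖f x - ∑ n ∈ s, c n * Complex.exp (-Complex.I * l n * x)‖ ≤ ε := by
  rcases le_or_gt R 0 with hR | hR
  · refine ⟨∅, 0, 0, ?_⟩
    have : volume (Icc (-R) R) = 0 := by
      rw [Real.volume_Icc]; exact ENNReal.ofReal_of_nonpos (by linarith)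
    rw [Measure.restrict_eq_zero.2 this, integral_zero_measure]
    exact hε.le
  have hT : 0 < 2 * R := by positivity
  have : Fact (0 < 2 * R) := ⟨hT⟩
  have hf1 : MemLp f 1 (volume.restrict (Ioc (-R) (-R + 2 * R))) :=
    memLp_one_iff_integrable.2 ((hf.integrableOn_isCompact isCompact_Icc).mono_set Ioc_subset_Icc_self)
  have hF : MemLp (AddCircle.liftIoc (2 * R) (-R) f) 1 (@AddCircle.haarAddCircle (2 * R) _) :=
    hf1.memLp_liftIoc.haarAddCircle
  have hmem : hF.toLp ∈ (Submodule.span ℂ (range (@fourierLp (2 * R) _ 1 _))).topologicalClosure := by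
    rw [span_fourierLp_closure_eq_top (by simp)]; trivial
  -- Haar measure on the circle has total mass 1, hence the division by the length 2R.
  obtain ⟨p, hp, hdist⟩ := Metric.mem_closure_iff.1 hmem (ε / (2 * R)) (by positivity)
  obtain ⟨c, rfl⟩ := Finsupp.mem_span_range_iff_exists_finsupp.1 hp
  -- The sign turns the characters exp(2πinx/(2R)) into the form exp(-ilx).
  refine ⟨c.support, c, fun n => -(2 * Real.pi * n / (2 * R)), ?_⟩
  set P : AddCircle (2 * R) → ℂ := fun x => ∑ n ∈ c.support, c n * fourier n x with hP
  have hae : (hF.toLp - c.sum fun i a => a • @fourierLp (2 * R) _ 1 _ i :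
      Lp ℂ 1 (@AddCircle.haarAddCircle (2 * R) _)) =ᵐ[AddCircle.haarAddCircle]
      fun x => AddCircle.liftIoc (2 * R) (-R) f x - P x := by
    have hsum : ∀ s : Finset ℤ, ((∑ n ∈ s, c n • @fourierLp (2 * R) _ 1 _ n :
        Lp ℂ 1 (@AddCircle.haarAddCircle (2 * R) _)) : AddCircle (2 * R) → ℂ)
        =ᵐ[AddCircle.haarAddCircle] fun x => ∑ n ∈ s, c n * fourier n x := by
      intro s
      induction s using Finset.induction_on with
      | empty =>
        filter_upwards [Lp.coeFn_zero ℂ 1 (@AddCircle.haarAddCircle (2 * R) _)] with x hx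
        rw [Finset.sum_empty, hx, Finset.sum_empty]
        rfl
      | insert a s ha ih =>
        rw [Finset.sum_insert ha]
        filter_upwards [ih, Lp.coeFn_add (c a • @fourierLp (2 * R) _ 1 _ a)
          (∑ n ∈ s, c n • @fourierLp (2 * R) _ 1 _ n),
          Lp.coeFn_smul (c a) (@fourierLp (2 * R) _ 1 _ a),
          coeFn_fourierLp (T := 2 * R) 1 a] with x h1 h2 h3 h4
        rw [h2, Pi.add_apply, h1, h3, Pi.smul_apply, h4, Finset.sum_insert ha, smul_eq_mul]
    filter_upwards [Lp.coeFn_sub hF.toLp (c.sum fun i a => a • @fourierLp (2 * R) _ 1 _ i),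
      hF.coeFn_toLp, hsum c.support] with x h1 h2 h3
    rw [h1, Pi.sub_apply, h2, Finsupp.sum, h3]
  rw [dist_eq_norm, L1.norm_eq_integral_norm, integral_congr_ae (hae.mono fun x hx => congrArg norm hx),
    AddCircle.integral_haarAddCircle, ← AddCircle.intervalIntegral_preimage (2 * R) (-R),
    smul_eq_mul, inv_mul_lt_iff₀ hT, mul_div_cancel₀ _ hT.ne',
    intervalIntegral.integral_of_le (by linarith)] at hdist
  refine le_of_eq_of_le ?_ hdist.le
  rw [integral_Icc_eq_integral_Ioc, show -R + 2 * R = R by ring]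
  refine setIntegral_congr_fun measurableSet_Ioc fun x hx => ?_
  have hx' : x ∈ Ioc (-R) (-R + 2 * R) := by rwa [show -R + 2 * R = R by ring]
  simp only [AddCircle.liftIoc_coe_apply hx', hP, fourier_coe_apply]
  congr 2
  refine Finset.sum_congr rfl fun n _ => ?_
  congr 2
  push_cast
  ring

/-! ### Smooth approximation and regularity of the transform -/

/-- A bump equal to 1 on [-t, t] and bounded by 1 fixes g, so cutting off a smooth approximant does
not increase the error. The price is the doubled support. -/
theorem MeasureTheory.MemLp.exists_smooth_approx_of_support_subset {g : ℝ → ℂ} (hg : MemLp g 2)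
    {t : ℝ} (ht : 0 < t) (hs : Function.support g ⊆ Icc (-t) t) {ε : ℝ} (hε : 0 < ε) :
    ∃ h : ℝ → ℂ, ContDiff ℝ ∞ h ∧ HasCompactSupport h ∧
      Function.support h ⊆ Icc (-(2 * t)) (2 * t) ∧ eLpNorm (g - h) 2 ≤ ENNReal.ofReal ε := by
  obtain ⟨h, hc, hd, hh⟩ := MemLp.exist_eLpNorm_sub_le (by norm_num) (by norm_num) hg hε
  let χ : ContDiffBump (0 : ℝ) := ⟨t, 2 * t, ht, by linarith⟩
  have hχ : ContDiff ℝ ∞ (fun x => (χ x : ℂ)) := Complex.ofRealCLM.contDiff.comp χ.contDiff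
  refine ⟨fun x => χ x * h x, hχ.mul hd, hc.mul_left, fun x hx => ?_, ?_⟩
  · have : x ∈ Function.support χ := fun h0 => hx (by simp [h0])
    rw [χ.support_eq, Real.ball_eq_Ioo] at this
    exact ⟨by linarith [this.1], by linarith [this.2]⟩
  · refine (eLpNorm_mono fun x => ?_).trans hh
    have hgx : g x = χ x * g x := by
      by_cases hx : x ∈ Icc (-t) t
      · rw [χ.one_of_mem_closedBall]
        · simp
        · rw [Real.closedBall_eq_Icc]; simpa [χ] using hx
      · rw [Function.notMem_support.1 fun h => hx (hs h)]; simp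
    rw [Pi.sub_apply, Pi.sub_apply]
    calc ‖g x - χ x * h x‖ = ‖(χ x : ℂ) * (g x - h x)‖ := by rw [mul_sub, ← hgx]
      _ ≤ 1 * ‖g x - h x‖ := by
          rw [norm_mul, Complex.norm_real, Real.norm_of_nonneg χ.nonneg]
          gcongr
          exact χ.le_one
      _ = _ := one_mul _

theorem integrable_of_memLp_two_of_support_subset {g : ℝ → ℂ} (hg : MemLp g 2) {a b : ℝ}
    (hs : Function.support g ⊆ Icc a b) : Integrable g := by
  rw [← integrableOn_iff_integrable_of_support_subset hs]
  exact (hg.restrict _).integrable (by norm_num)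

/-- Cauchy–Schwarz on an interval of length 2T, with the factor (2π)^(-1/2) ≤ 1 discarded. It makes
point evaluations continuous on L²[-T, T]. -/
theorem enorm_fourierT_le {g : ℝ → ℂ} (hg : MemLp g 2) {T : ℝ}
    (hs : Function.support g ⊆ Icc (-T) T) (x : ℝ) :
    ‖fourierT g x‖ₑ ≤ ENNReal.ofReal (2 * T) ^ (1 / 2 : ℝ) * eLpNorm g 2 := by
  have h1 : ‖fourierT g x‖ₑ ≤ eLpNorm g 1 := by
    rw [fourierT, enorm_mul, eLpNorm_one_eq_lintegral_enorm, ← one_mul (∫⁻ x, ‖g x‖ₑ)]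
    refine mul_le_mul' ?_ ((enorm_integral_le_lintegral_enorm _).trans_eq ?_)
    · rw [← ofReal_norm, ENNReal.ofReal_le_one, Complex.norm_real,
        Real.norm_of_nonneg (by positivity)]
      refine inv_le_one_of_one_le₀ (Real.one_le_sqrt.2 ?_)
      linarith [Real.pi_gt_three]
    · refine lintegral_congr fun s => ?_
      have : ‖Complex.exp (-Complex.I * x * s)‖ₑ = 1 := by
        rw [← ofReal_norm, Complex.norm_exp]; simp
      rw [enorm_mul, this, one_mul]
  refine h1.trans ?_
  have hres : ∀ p : ℝ≥0∞, eLpNorm g p (volume.restrict (Icc (-T) T)) = eLpNorm g p :=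
    fun p => eLpNorm_restrict_eq_of_support_subset hs
  have h2 := eLpNorm_le_eLpNorm_mul_rpow_measure_univ (p := 1) (q := 2) (by norm_num)
    (hg.restrict (Icc (-T) T)).aestronglyMeasurable
  rw [hres, hres, Measure.restrict_apply_univ, Real.volume_Icc, mul_comm,
    show T - -T = 2 * T by ring] at h2
  norm_num at h2 ⊢
  exact h2

theorem integrable_exp_mul {g : ℝ → ℂ} (hg : Integrable g) (x : ℝ) :
    Integrable (fun s : ℝ => Complex.exp (-Complex.I * x * s) * g s) := by
  refine hg.mono ((Continuous.aestronglyMeasurable (by fun_prop)).mul hg.aestronglyMeasurable)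
    (Eventually.of_forall fun s => ?_)
  rw [norm_mul, Complex.norm_exp]; simp

theorem fourierT_sub {g h : ℝ → ℂ} (hg : Integrable g) (hh : Integrable h) (x : ℝ) :
    fourierT (g - h) x = fourierT g x - fourierT h x := by
  simp only [fourierT, Pi.sub_apply, mul_sub]
  rw [integral_sub (integrable_exp_mul hg x) (integrable_exp_mul hh x), mul_sub]

theorem continuous_fourierT_ofReal {g : ℝ → ℂ} (hg : Integrable g) :
    Continuous fun x : ℝ => fourierT g x := by
  refine continuous_const.mul (continuous_of_dominated (bound := fun s => ‖g s‖)
    (fun x => (integrable_exp_mul hg x).aestronglyMeasurable)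
    (fun x => Eventually.of_forall fun s => ?_) hg.norm
    (Eventually.of_forall fun s => by fun_prop))
  rw [norm_mul, Complex.norm_exp]; simp

/-- On the bounded support the exponential is bounded locally uniformly in z, which permits
differentiation under the integral. -/
theorem differentiable_fourierT {g : ℝ → ℂ} (hg : Integrable g) {a b : ℝ}
    (hs : Function.support g ⊆ Icc a b) : Differentiable ℂ (fourierT g) := by
  set M := max |a| |b| with hM
  have hsM : ∀ s, g s ≠ 0 → |s| ≤ M := fun s h => abs_le_max_abs_abs (hs h).1 (hs h).2
  have hexp : ∀ (z : ℂ) (s : ℝ), g s ≠ 0 →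
      ‖Complex.exp (-Complex.I * z * s)‖ ≤ Real.exp (‖z‖ * M) := fun z s h => by
    refine (Complex.norm_exp_le_exp_norm _).trans (Real.exp_le_exp.2 ?_)
    rw [norm_mul, norm_mul, norm_neg, Complex.norm_I, one_mul, Complex.norm_real, Real.norm_eq_abs]
    exact mul_le_mul_of_nonneg_left (hsM s h) (norm_nonneg z)
  have hmeas : ∀ z : ℂ, AEStronglyMeasurable
      (fun s : ℝ => Complex.exp (-Complex.I * z * s) * g s) volume := fun z =>
    (Continuous.aestronglyMeasurable (by fun_prop)).mul hg.aestronglyMeasurable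
  intro z₀
  refine DifferentiableAt.const_mul (HasDerivAt.differentiableAt
    (hasDerivAt_integral_of_dominated_loc_of_deriv_le
    (F' := fun z s => -Complex.I * s * (Complex.exp (-Complex.I * z * s) * g s))
    (bound := fun s => M * (Real.exp ((‖z₀‖ + 1) * M) * ‖g s‖))
    (Metric.ball_mem_nhds z₀ one_pos) (Eventually.of_forall hmeas) ?_ ?_ ?_ ?_ ?_).2) _
  · refine (hg.norm.const_mul (Real.exp (‖z₀‖ * M))).mono' (hmeas z₀)
      (Eventually.of_forall fun s => ?_)
    by_cases h : g s = 0
    · simp [h]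
    · rw [norm_mul]
      gcongr
      exact hexp z₀ s h
  · exact (Continuous.aestronglyMeasurable (by fun_prop)).mul (hmeas z₀)
  · refine Eventually.of_forall fun s z hz => ?_
    by_cases h : g s = 0
    · simp [h]
    · have hz' : ‖z‖ ≤ ‖z₀‖ + 1 := by
        have h1 := norm_sub_norm_le z z₀
        rw [mem_ball_iff_norm] at hz
        linarith
      have hM0 : 0 ≤ M := (abs_nonneg s).trans (hsM s h)
      simp only [norm_mul, norm_neg, Complex.norm_I, one_mul, Complex.norm_real, Real.norm_eq_abs]
      gcongr
      · exact hsM s h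
      · exact (hexp z s h).trans (Real.exp_le_exp.2 (by gcongr))
  · exact (hg.norm.const_mul _).const_mul _
  · refine Eventually.of_forall fun s z _ => ?_
    have h1 : HasDerivAt (fun w : ℂ => -Complex.I * w * s) (-Complex.I * s) z := by
      simpa using ((hasDerivAt_id z).const_mul (-Complex.I)).mul_const (s : ℂ)
    exact (h1.cexp.mul_const (g s)).congr_deriv (by ring)

/-! ### The two estimates for smooth functions -/

theorem MeasureTheory.MemLp.eLpNorm_two_eq_ofReal_sqrt {α : Type*} [MeasurableSpace α]
    {μ : Measure α} {f : α → ℂ} (hf : MemLp f 2 μ) :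
    eLpNorm f 2 μ = ENNReal.ofReal (Real.sqrt (∫ x, ‖f x‖ ^ 2 ∂μ)) := by
  rw [hf.eLpNorm_eq_integral_rpow_norm (by norm_num) (by norm_num), Real.sqrt_eq_rpow]
  norm_num

theorem memLp_two_fourierT {μ : Measure ℝ} (hμ : IsPoissonFinite μ) {g : ℝ → ℂ}
    (hg : ContDiff ℝ ∞ g) (hc : HasCompactSupport g) :
    MemLp (fun x : ℝ => fourierT g x) 2 μ :=
  (memLp_two_iff_integrable_sq_norm (continuous_fourierT_ofReal
    (hg.continuous.integrable_of_hasCompactSupport hc)).aestronglyMeasurable).2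
    (integrable_norm_sq_fourierT hμ hg hc)

/-- Converts the quadratic estimate into one that is linear in the norm and the point evaluations.
-/
theorem sqrt_add_sum_sq_le {ι : Type*} (s : Finset ι) {x : ℝ} (hx : 0 ≤ x) {a : ι → ℝ}
    (ha : ∀ i, 0 ≤ a i) : Real.sqrt (x + ∑ i ∈ s, a i ^ 2) ≤ Real.sqrt x + ∑ i ∈ s, a i := by
  have hs : 0 ≤ ∑ i ∈ s, a i := Finset.sum_nonneg fun i _ => ha i
  have h := Finset.sum_sq_le_sq_sum_of_nonneg (s := s) (f := a) fun i _ => ha i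
  refine Real.sqrt_le_iff.2 ⟨by positivity, ?_⟩
  nlinarith [Real.sq_sqrt hx, mul_nonneg (Real.sqrt_nonneg x) hs]

theorem FourierEqDeltaAdd.normL2_le_of_smooth {μ : Measure ℝ} {C : ℝ} {f : ℝ → ℂ}
    (h : FourierEqDeltaAdd μ C f) (hμ : IsPoissonFinite μ) (hC : 0 < C)
    (hf : LocallyIntegrable f) (T : ℝ) :
    ∃ B : ℝ, 0 < B ∧ ∀ g : ℝ → ℂ, ContDiff ℝ ∞ g → HasCompactSupport g →
      Function.support g ⊆ Icc (-T) T → normL2 μ (fourierT g) ≤ ENNReal.ofReal B * eLpNorm g 2 := by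
  set F := ∫ x in Icc (-(2 * T)) (2 * T), ‖f x‖ with hF
  have hF0 : 0 ≤ F := integral_nonneg fun x => norm_nonneg _
  have hp : 0 < Real.sqrt (2 * Real.pi) := by positivity
  refine ⟨Real.sqrt ((C + F) / Real.sqrt (2 * Real.pi)), by positivity, fun g hg hc hs => ?_⟩
  rw [normL2, (memLp_two_fourierT hμ hg hc).eLpNorm_two_eq_ofReal_sqrt,
    (hg.continuous.memLp_of_hasCompactSupport hc).eLpNorm_two_eq_ofReal_sqrt,
    ← ENNReal.ofReal_mul (Real.sqrt_nonneg _), ← Real.sqrt_mul (by positivity)]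
  refine ENNReal.ofReal_le_ofReal (Real.sqrt_le_sqrt ?_)
  have h1 := congrArg norm (h.integral_norm_sq hg hc)
  have h2 := norm_integral_mul_autocorr_le hf hg hc hs
  have hE : 0 ≤ ∫ s, ‖g s‖ ^ 2 := integral_nonneg fun x => by positivity
  have hI : 0 ≤ ∫ x : ℝ, ‖fourierT g x‖ ^ 2 ∂μ := integral_nonneg fun x => by positivity
  rw [Complex.norm_real, Real.norm_of_nonneg (by positivity)] at h1
  have h3 := h1.le.trans (norm_add_le _ _)
  rw [Complex.norm_real, Real.norm_of_nonneg (by positivity)] at h3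
  rw [div_mul_eq_mul_div, le_div_iff₀ hp]
  linarith

/-- A trigonometric polynomial `L¹`-close to `f` gives a lower bound for the norm of the transform
in `L²(μ)` up to finitely many point evaluations. -/
theorem FourierEqDeltaAdd.le_normL2_add_sum_of_smooth {μ : Measure ℝ} {C : ℝ} {f : ℝ → ℂ}
    (h : FourierEqDeltaAdd μ C f) (hμ : IsPoissonFinite μ) (hC : 0 < C)
    (hf : LocallyIntegrable f) {T : ℝ} {ι : Type*} {s : Finset ι} {c : ι → ℂ} {l : ι → ℝ}
    (happ : ∫ x in Icc (-(2 * T)) (2 * T),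
      ‖f x - ∑ n ∈ s, c n * Complex.exp (-Complex.I * l n * x)‖ ≤ C / 2)
    {g : ℝ → ℂ} (hg : ContDiff ℝ ∞ g) (hc : HasCompactSupport g)
    (hs : Function.support g ⊆ Icc (-T) T) :
    ENNReal.ofReal (Real.sqrt (C / 2 / Real.sqrt (2 * Real.pi))) * eLpNorm g 2 ≤
      normL2 μ (fourierT g) +
        ∑ n ∈ s, ENNReal.ofReal (Real.sqrt (Real.sqrt (2 * Real.pi) * ‖c n‖)) *
          ‖fourierT g (l n)‖ₑ := by
  have hp : 0 < Real.sqrt (2 * Real.pi) := by positivity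
  have hgi := hg.continuous.integrable_of_hasCompactSupport (μ := volume) hc
  set E := ∫ s, ‖g s‖ ^ 2 with hEdef
  set I := ∫ x : ℝ, ‖fourierT g x‖ ^ 2 ∂μ with hIdef
  have hE : 0 ≤ E := integral_nonneg fun x => by positivity
  have hI : 0 ≤ I := integral_nonneg fun x => by positivity
  -- The weights make √(2π) a(n)² equal to 2π‖c n‖ |ĝ(l n)|², the bound for the n-th term of ∫ p A.
  set a : ι → ℝ := fun n => Real.sqrt (Real.sqrt (2 * Real.pi) * ‖c n‖) * ‖fourierT g (l n)‖ with ha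
  have ha0 : ∀ n, 0 ≤ a n := fun n => by positivity
  set p : ℝ → ℂ := fun x => ∑ n ∈ s, c n * Complex.exp (-Complex.I * l n * x) with hpdef
  have hpc : Continuous p := by fun_prop
  have hfp : LocallyIntegrable (fun x => f x - p x) := hf.sub hpc.locallyIntegrable
  -- The part of ∫ f A coming from f - p is at most (C/2)E and is absorbed into CE.
  have key : C / 2 * E ≤ Real.sqrt (2 * Real.pi) * (I + ∑ n ∈ s, a n ^ 2) := by
    have h1 := h.integral_norm_sq hg hc
    have h2 := norm_integral_mul_autocorr_le hfp hg hc hs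
    have hpi : Integrable (fun x => p x * autocorr g x) :=
      integrable_mul_autocorr hpc.locallyIntegrable hg hc
    have h3 : ∫ x, f x * autocorr g x = (∫ x, (f x - p x) * autocorr g x) +
        ∫ x, p x * autocorr g x := by
      rw [← integral_add (integrable_mul_autocorr hfp hg hc) hpi]
      exact integral_congr_ae (Eventually.of_forall fun x => by ring)
    have h4 : ∫ x, p x * autocorr g x =
        ∑ n ∈ s, c n * ((2 * Real.pi * ‖fourierT g (l n)‖ ^ 2 : ℝ) : ℂ) := by
      simp only [hpdef, Finset.sum_mul]
      rw [integral_finsetSum]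
      · refine Finset.sum_congr rfl fun n _ => ?_
        simp only [mul_assoc (c n)]
        rw [integral_const_mul, integral_exp_mul_autocorr hgi]
      · intro n _
        exact integrable_mul_autocorr (Continuous.locallyIntegrable (by fun_prop)) hg hc
    have h5 : ‖∫ x, p x * autocorr g x‖ ≤ Real.sqrt (2 * Real.pi) * ∑ n ∈ s, a n ^ 2 := by
      rw [h4, Finset.mul_sum]
      refine (norm_sum_le _ _).trans (Finset.sum_le_sum fun n _ => le_of_eq ?_)
      rw [norm_mul, Complex.norm_real, Real.norm_of_nonneg (by positivity), ha]
      simp only [mul_pow]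
      rw [Real.sq_sqrt (by positivity)]
      linear_combination (-‖c n‖ * ‖fourierT g (l n)‖ ^ 2) *
        Real.mul_self_sqrt (show (0 : ℝ) ≤ 2 * Real.pi by positivity)
    have h6 : ((C * E : ℝ) : ℂ) = ((Real.sqrt (2 * Real.pi) * I : ℝ) : ℂ) -
        ((∫ x, (f x - p x) * autocorr g x) + ∫ x, p x * autocorr g x) := by
      rw [h1, ← h3]; ring
    have h7 := congrArg norm h6
    rw [Complex.norm_real, Real.norm_of_nonneg (by positivity)] at h7
    have h8 := h7.le.trans (norm_sub_le _ _)
    rw [Complex.norm_real, Real.norm_of_nonneg (by positivity)] at h8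
    have h9 := norm_add_le (∫ x, (f x - p x) * autocorr g x) (∫ x, p x * autocorr g x)
    have h10 := mul_le_mul_of_nonneg_right happ hE
    linarith
  have hsum : ∑ n ∈ s, ENNReal.ofReal (Real.sqrt (Real.sqrt (2 * Real.pi) * ‖c n‖)) *
          ‖fourierT g (l n)‖ₑ = ENNReal.ofReal (∑ n ∈ s, a n) := by
    rw [ENNReal.ofReal_sum_of_nonneg fun n _ => ha0 n]
    refine Finset.sum_congr rfl fun n _ => ?_
    rw [← ofReal_norm, ← ENNReal.ofReal_mul (Real.sqrt_nonneg _)]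
  rw [hsum, normL2, (memLp_two_fourierT hμ hg hc).eLpNorm_two_eq_ofReal_sqrt,
    (hg.continuous.memLp_of_hasCompactSupport hc).eLpNorm_two_eq_ofReal_sqrt,
    ← ENNReal.ofReal_mul (Real.sqrt_nonneg _), ← Real.sqrt_mul (by positivity),
    ← ENNReal.ofReal_add (Real.sqrt_nonneg _) (Finset.sum_nonneg fun n _ => ha0 n)]
  refine ENNReal.ofReal_le_ofReal (le_trans (Real.sqrt_le_sqrt ?_) (sqrt_add_sum_sq_le s hI ha0))
  rw [div_mul_eq_mul_div, div_le_iff₀ hp, mul_comm _ (Real.sqrt _)]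
  exact key

/-! ### From smooth functions to L² -/

/-- A smooth sequence approximating a compactly supported `L²` function. -/
theorem MeasureTheory.MemLp.exists_smooth_seq {g : ℝ → ℂ} (hg : MemLp g 2)
    {t : ℝ} (ht : 0 < t) (hs : Function.support g ⊆ Icc (-t) t) :
    ∃ h : ℕ → ℝ → ℂ, (∀ n, ContDiff ℝ ∞ (h n)) ∧ (∀ n, HasCompactSupport (h n)) ∧
      (∀ n, Function.support (h n) ⊆ Icc (-(2 * t)) (2 * t)) ∧
      Tendsto (fun n => eLpNorm (g - h n) 2) atTop (𝓝 0) := by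
  choose h h1 h2 h3 h4 using fun n : ℕ =>
    hg.exists_smooth_approx_of_support_subset ht hs (Nat.one_div_pos_of_nat (α := ℝ) (n := n))
  refine ⟨h, h1, h2, h3, tendsto_of_tendsto_of_tendsto_of_le_of_le tendsto_const_nhds ?_
    (fun _ => zero_le) h4⟩
  simpa using ENNReal.tendsto_ofReal (tendsto_one_div_add_atTop_nhds_zero_nat (𝕜 := ℝ))

theorem support_sub_subset {g h : ℝ → ℂ} {s : Set ℝ} (hg : Function.support g ⊆ s)
    (hh : Function.support h ⊆ s) : Function.support (g - h) ⊆ s :=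
  (Function.support_sub g h).trans (union_subset hg hh)

theorem tendsto_enorm_fourierT_sub {g : ℝ → ℂ} (hg : MemLp g 2) {h : ℕ → ℝ → ℂ}
    (hh : ∀ n, MemLp (h n) 2) {T : ℝ} (hgs : Function.support g ⊆ Icc (-T) T)
    (hhs : ∀ n, Function.support (h n) ⊆ Icc (-T) T)
    (hlim : Tendsto (fun n => eLpNorm (g - h n) 2) atTop (𝓝 0)) (x : ℝ) :
    Tendsto (fun n => ‖fourierT (g - h n) x‖ₑ) atTop (𝓝 0) := by
  refine tendsto_of_tendsto_of_tendsto_of_le_of_le tendsto_const_nhds ?_ (fun _ => zero_le)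
    fun n => enorm_fourierT_le (hg.sub (hh n)) (support_sub_subset hgs (hhs n)) x
  simpa using ENNReal.Tendsto.const_mul hlim (Or.inr (by finiteness))

theorem tendsto_fourierT {g : ℝ → ℂ} (hg : MemLp g 2) {h : ℕ → ℝ → ℂ}
    (hh : ∀ n, MemLp (h n) 2) {T : ℝ} (hgs : Function.support g ⊆ Icc (-T) T)
    (hhs : ∀ n, Function.support (h n) ⊆ Icc (-T) T)
    (hlim : Tendsto (fun n => eLpNorm (g - h n) 2) atTop (𝓝 0)) (x : ℝ) :
    Tendsto (fun n => fourierT (h n) x) atTop (𝓝 (fourierT g x)) := by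
  have h1 := tendsto_enorm_fourierT_sub hg hh hgs hhs hlim x
  rw [tendsto_iff_edist_tendsto_0]
  refine h1.congr fun n => ?_
  rw [fourierT_sub (integrable_of_memLp_two_of_support_subset hg hgs)
    (integrable_of_memLp_two_of_support_subset (hh n) (hhs n)), edist_comm, edist_eq_enorm_sub]

theorem eLpNorm_two_le_add_eLpNorm_sub {μ : Measure ℝ} {f g : ℝ → ℂ}
    (hf : AEStronglyMeasurable f μ) (hg : AEStronglyMeasurable g μ) :
    eLpNorm f 2 μ ≤ eLpNorm g 2 μ + eLpNorm (g - f) 2 μ := by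
  have h := eLpNorm_sub_le (p := 2) hg (hg.sub hf) one_le_two
  have : g - (g - f) = f := sub_sub_cancel g f
  rwa [this] at h

theorem eLpNorm_two_sub_comm {μ : Measure ℝ} (f g : ℝ → ℂ) :
    eLpNorm (f - g) 2 μ = eLpNorm (g - f) 2 μ := eLpNorm_sub_comm f g 2 μ

/-- The transforms of the approximants converge pointwise, so Fatou's lemma carries the bound to the
limit. The constant is that of [-2t, 2t], where the approximants live. -/
theorem FourierEqDeltaAdd.normL2_le {μ : Measure ℝ} {C : ℝ} {f : ℝ → ℂ}
    (h : FourierEqDeltaAdd μ C f) (hμ : IsPoissonFinite μ) (hC : 0 < C)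
    (hf : LocallyIntegrable f) {t : ℝ} (ht : 0 < t) :
    ∃ B : ℝ, 0 < B ∧ ∀ g : ℝ → ℂ, MemLp g 2 → Function.support g ⊆ Icc (-t) t →
      normL2 μ (fourierT g) ≤ ENNReal.ofReal B * eLpNorm g 2 := by
  obtain ⟨B, hB, hBg⟩ := h.normL2_le_of_smooth hμ hC hf (2 * t)
  refine ⟨B, hB, fun g hg hs => ?_⟩
  obtain ⟨u, hu1, hu2, hu3, hu4⟩ := hg.exists_smooth_seq ht hs
  have hum : ∀ n, MemLp (u n) 2 := fun n => (hu1 n).continuous.memLp_of_hasCompactSupport (hu2 n)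
  have hs' : Function.support g ⊆ Icc (-(2 * t)) (2 * t) :=
    hs.trans (Icc_subset_Icc (by linarith) (by linarith))
  refine (Lp.eLpNorm_lim_le_liminf_eLpNorm (f := fun n (x : ℝ) => fourierT (u n) x)
    (fun n => (memLp_two_fourierT hμ (hu1 n) (hu2 n)).aestronglyMeasurable) _
    (Eventually.of_forall fun x => tendsto_fourierT hg hum hs' hu3 hu4 x)).trans ?_
  have hlim : Tendsto (fun n => ENNReal.ofReal B * (eLpNorm g 2 + eLpNorm (g - u n) 2)) atTop
      (𝓝 (ENNReal.ofReal B * eLpNorm g 2)) := by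
    have := ENNReal.Tendsto.const_mul (a := ENNReal.ofReal B) (hu4.const_add (eLpNorm g 2))
      (Or.inr (by finiteness))
    simpa using this
  rw [← hlim.liminf_eq]
  refine liminf_le_liminf (Eventually.of_forall fun n => (hBg _ (hu1 n) (hu2 n) (hu3 n)).trans ?_)
  gcongr
  exact eLpNorm_two_le_add_eLpNorm_sub (hum n).aestronglyMeasurable hg.aestronglyMeasurable

/-- The upper bound applied to g - u n controls the transforms in L²(μ), and the finitely many
evaluations converge. One doubling of t comes from the cutoff, the other from the autocorrelation.
-/
theorem FourierEqDeltaAdd.le_normL2_add_sum {μ : Measure ℝ} {C : ℝ} {f : ℝ → ℂ}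
    (h : FourierEqDeltaAdd μ C f) (hμ : IsPoissonFinite μ) (hC : 0 < C)
    (hf : LocallyIntegrable f) {t : ℝ} (ht : 0 < t) {ι : Type*} {s : Finset ι} {c : ι → ℂ}
    {l : ι → ℝ} (happ : ∫ x in Icc (-(2 * (2 * t))) (2 * (2 * t)),
      ‖f x - ∑ n ∈ s, c n * Complex.exp (-Complex.I * l n * x)‖ ≤ C / 2)
    {g : ℝ → ℂ} (hg : MemLp g 2) (hs : Function.support g ⊆ Icc (-t) t) :
    ENNReal.ofReal (Real.sqrt (C / 2 / Real.sqrt (2 * Real.pi))) * eLpNorm g 2 ≤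
      normL2 μ (fourierT g) +
        ∑ n ∈ s, ENNReal.ofReal (Real.sqrt (Real.sqrt (2 * Real.pi) * ‖c n‖)) *
          ‖fourierT g (l n)‖ₑ := by
  set k := ENNReal.ofReal (Real.sqrt (C / 2 / Real.sqrt (2 * Real.pi))) with hk
  set a : ι → ℝ≥0∞ := fun n => ENNReal.ofReal (Real.sqrt (Real.sqrt (2 * Real.pi) * ‖c n‖)) with ha
  obtain ⟨B, hB, hBg⟩ := h.normL2_le hμ hC hf (t := 2 * t) (by positivity)
  obtain ⟨u, hu1, hu2, hu3, hu4⟩ := hg.exists_smooth_seq ht hs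
  have hum : ∀ n, MemLp (u n) 2 := fun n => (hu1 n).continuous.memLp_of_hasCompactSupport (hu2 n)
  have hs' : Function.support g ⊆ Icc (-(2 * t)) (2 * t) :=
    hs.trans (Icc_subset_Icc (by linarith) (by linarith))
  have hgi := integrable_of_memLp_two_of_support_subset hg hs
  have hui := fun n => integrable_of_memLp_two_of_support_subset (hum n) (hu3 n)
  have hstep : ∀ n, k * eLpNorm g 2 ≤ (normL2 μ (fourierT g) + ENNReal.ofReal B * eLpNorm (g - u n) 2) +
      ∑ i ∈ s, a i * ‖fourierT (u n) (l i)‖ₑ + k * eLpNorm (g - u n) 2 := by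
    intro n
    have h1 : eLpNorm g 2 ≤ eLpNorm (u n) 2 + eLpNorm (g - u n) 2 := by
      rw [eLpNorm_two_sub_comm]
      exact eLpNorm_two_le_add_eLpNorm_sub hg.aestronglyMeasurable (hum n).aestronglyMeasurable
    have h2 : normL2 μ (fourierT (u n)) ≤
        normL2 μ (fourierT g) + ENNReal.ofReal B * eLpNorm (g - u n) 2 := by
      refine le_trans ?_ (add_le_add le_rfl
        (hBg _ (hg.sub (hum n)) (support_sub_subset hs' (hu3 n))))
      have : (fun x : ℝ => fourierT (g - u n) x) =
          (fun x : ℝ => fourierT g x) - fun x : ℝ => fourierT (u n) x :=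
        funext fun x => fourierT_sub hgi (hui n) x
      rw [normL2, normL2, normL2, this]
      exact eLpNorm_two_le_add_eLpNorm_sub (continuous_fourierT_ofReal (hui n)).aestronglyMeasurable
        (continuous_fourierT_ofReal hgi).aestronglyMeasurable
    have h3 := h.le_normL2_add_sum_of_smooth hμ hC hf happ (hu1 n) (hu2 n) (hu3 n)
    have h4 : k * eLpNorm g 2 ≤ k * eLpNorm (u n) 2 + k * eLpNorm (g - u n) 2 :=
      (mul_le_mul_right h1 k).trans_eq (mul_add _ _ _)
    exact h4.trans (add_le_add_left (h3.trans (add_le_add_left h2 _)) _)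
  refine ge_of_tendsto' (x := atTop) ?_ hstep
  have hB0 : Tendsto (fun n => ENNReal.ofReal B * eLpNorm (g - u n) 2) atTop (𝓝 0) := by
    simpa using ENNReal.Tendsto.const_mul (a := ENNReal.ofReal B) hu4 (Or.inr (by finiteness))
  have hk0 : Tendsto (fun n => k * eLpNorm (g - u n) 2) atTop (𝓝 0) := by
    simpa using ENNReal.Tendsto.const_mul (a := k) hu4 (Or.inr (by finiteness))
  have hsum : Tendsto (fun n => ∑ i ∈ s, a i * ‖fourierT (u n) (l i)‖ₑ) atTop
      (𝓝 (∑ i ∈ s, a i * ‖fourierT g (l i)‖ₑ)) :=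
    tendsto_finsetSum s fun i _ => ENNReal.Tendsto.const_mul
      ((tendsto_fourierT hg hum hs' hu3 hu4 (l i)).enorm) (Or.inr (by finiteness))
  have hall := ((hB0.const_add (normL2 μ (fourierT g))).add hsum).add hk0
  rwa [add_zero, add_zero] at hall

/-! ### Lebesgue measure as a special case -/

theorem isPoissonFinite_volume : IsPoissonFinite volume := by
  have h := integrable_inv_one_add_sq.hasFiniteIntegral
  rw [hasFiniteIntegral_iff_ofReal (Eventually.of_forall fun x => by positivity)] at h
  simpa [IsPoissonFinite] using h

/-- Fourier inversion at the origin, as an identity for Lebesgue measure. -/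
theorem fourierEqDeltaAdd_volume : FourierEqDeltaAdd volume (Real.sqrt (2 * Real.pi)) 0 := by
  intro φ hφ hc
  have hp : 0 < Real.sqrt (2 * Real.pi) := by positivity
  set S := hc.toSchwartzMap hφ
  have hinv : ∫ w : ℝ, 𝓕 φ w = φ 0 := by
    have hS : 𝓕 φ = (𝓕 S : SchwartzMap ℝ ℂ) := by
      rw [SchwartzMap.fourier_coe]; rfl
    have h1 : 𝓕⁻ (𝓕 φ) 0 = φ 0 := (hφ.continuous.integrable_of_hasCompactSupport
      hc).fourierInv_fourier_eq (by rw [hS]; exact (𝓕 S : SchwartzMap ℝ ℂ).integrable)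
      hφ.continuous.continuousAt
    rw [← h1, Real.fourierInv_eq']
    simp
  simp only [fourierT_ofReal, Pi.zero_apply, zero_mul, integral_zero, add_zero]
  rw [integral_const_mul, Measure.integral_comp_div (𝓕 φ), hinv, abs_of_pos Real.two_pi_pos,
    Complex.real_smul, ← mul_assoc, ← Complex.ofReal_mul]
  congr 2
  rw [inv_mul_eq_iff_eq_mul₀ hp.ne', Real.mul_self_sqrt (by positivity)]

/-! ### Removing a finite-dimensional error -/

/-- An injective operator that is bounded below up to a finite-dimensional error is bounded
below. -/
theorem ContinuousLinearMap.exists_le_norm_of_finiteDimensional {H E F : Type*}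
    [NormedAddCommGroup H] [NormedSpace ℂ H] [CompleteSpace H]
    [NormedAddCommGroup E] [NormedSpace ℂ E]
    [NormedAddCommGroup F] [NormedSpace ℂ F] [FiniteDimensional ℂ F]
    (S : H →L[ℂ] E) (L : H →L[ℂ] F) (hS : ∀ x, S x = 0 → x = 0) {k M : ℝ} (hk : 0 < k)
    (hM : 0 ≤ M) (h : ∀ x, k * ‖x‖ ≤ ‖S x‖ + M * ‖L x‖) :
    ∃ c : ℝ, 0 < c ∧ ∀ x, c * ‖x‖ ≤ ‖S x‖ := by
  -- The product carries the sup norm, so both terms are bounded by the norm of the pair, whence the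
  -- factor 1 + M. Consequently the pair is a closed embedding.
  have hanti : AntilipschitzWith (Real.toNNReal ((1 + M) / k)) (S.prod L) := by
    refine AddMonoidHomClass.antilipschitz_of_bound _ fun x => ?_
    rw [Real.coe_toNNReal _ (by positivity), div_mul_eq_mul_div, le_div_iff₀ hk]
    have h1 : ‖S x‖ ≤ ‖(S.prod L) x‖ := le_max_left _ _
    have h2 : ‖L x‖ ≤ ‖(S.prod L) x‖ := le_max_right _ _
    have h3 := mul_le_mul_of_nonneg_left h2 hM
    linarith [h x]
  have hemb := hanti.isClosedEmbedding (S.prod L).uniformContinuous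
  -- Otherwise there are unit vectors y n with S (y n) → 0. Compactness makes L (y n) converge along
  -- a subsequence, and then the closed embedding makes y converge to a unit vector in the kernel of
  -- S.
  by_contra! hcon
  choose x hx using fun n : ℕ => hcon (1 / (n + 1)) Nat.one_div_pos_of_nat
  have hx0 : ∀ n, 0 < ‖x n‖ := fun n => norm_pos_iff.2 fun h0 => by
    have := hx n
    simp [h0] at this
  set y : ℕ → H := fun n => ((‖x n‖⁻¹ : ℝ) : ℂ) • x n with hy
  have hnorm : ∀ n, ‖((‖x n‖⁻¹ : ℝ) : ℂ)‖ = ‖x n‖⁻¹ := fun n => by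
    rw [Complex.norm_real, Real.norm_of_nonneg (by positivity)]
  have hy1 : ∀ n, ‖y n‖ = 1 := fun n => by
    rw [hy, norm_smul, hnorm, inv_mul_cancel₀ (hx0 n).ne']
  have hyS : Tendsto (fun n => S (y n)) atTop (𝓝 0) := by
    refine squeeze_zero_norm (fun n => ?_) (tendsto_one_div_add_atTop_nhds_zero_nat (𝕜 := ℝ))
    rw [hy, map_smul, norm_smul, hnorm, inv_mul_le_iff₀ (hx0 n), mul_comm]
    exact (hx n).le
  have : ProperSpace F := FiniteDimensional.proper ℂ F
  obtain ⟨w, -, ψ, hψ, hw⟩ := (isCompact_closedBall (0 : F) ‖L‖).tendsto_subseq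
    (x := fun n => L (y n)) fun n => by
      rw [mem_closedBall_zero_iff]
      simpa [hy1 n] using L.le_opNorm (y n)
  have hlim : Tendsto (fun n => (S.prod L) (y (ψ n))) atTop (𝓝 (0, w)) :=
    (hyS.comp hψ.tendsto_atTop).prodMk_nhds hw
  obtain ⟨z, hz⟩ := hemb.isClosed_range.mem_of_tendsto hlim
    (Eventually.of_forall fun n => mem_range_self _)
  rw [← hz] at hlim
  have hyz : Tendsto (fun n => y (ψ n)) atTop (𝓝 z) := hemb.tendsto_nhds_iff.2 hlim
  have hz1 : ‖z‖ = 1 := tendsto_nhds_unique hyz.norm (by simp [hy1])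
  have hz0 : z = 0 := hS z (congrArg Prod.fst hz)
  simp [hz0] at hz1

/-! ### The transform as an operator from L²[-t, t] to L²(μ) -/

theorem fourierT_congr_ae {g h : ℝ → ℂ} (hgh : g =ᵐ[volume] h) (z : ℂ) :
    fourierT g z = fourierT h z := by
  unfold fourierT
  congr 1
  refine integral_congr_ae (hgh.mono fun s hs => ?_)
  simp only [hs]

theorem fourierT_add {g h : ℝ → ℂ} (hg : Integrable g) (hh : Integrable h) (x : ℝ) :
    fourierT (g + h) x = fourierT g x + fourierT h x := by
  simp only [fourierT, Pi.add_apply, mul_add]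
  rw [integral_add (integrable_exp_mul hg x) (integrable_exp_mul hh x), mul_add]

theorem fourierT_const_smul (c : ℂ) (g : ℝ → ℂ) (z : ℂ) :
    fourierT (c • g) z = c * fourierT g z := by
  simp only [fourierT, Pi.smul_apply, smul_eq_mul]
  have h : ∫ s : ℝ, Complex.exp (-Complex.I * z * s) * (c * g s) =
      c * ∫ s : ℝ, Complex.exp (-Complex.I * z * s) * g s := by
    rw [← integral_const_mul]
    exact integral_congr_ae (.of_forall fun s => mul_left_comm _ _ _)
  rw [h, mul_left_comm]

/-- The extension by zero to the line of an element of `L²[-t, t]`. -/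
noncomputable def extendZero (t : ℝ) (h : Lp ℂ 2 (volume.restrict (Icc (-t) t))) : ℝ → ℂ :=
  (Icc (-t) t).indicator h

section extendZero

variable {t : ℝ} (h h' : Lp ℂ 2 (volume.restrict (Icc (-t) t)))

theorem support_extendZero_subset : Function.support (extendZero t h) ⊆ Icc (-t) t :=
  support_indicator_subset

theorem memLp_extendZero : MemLp (extendZero t h) 2 :=
  (memLp_indicator_iff_restrict measurableSet_Icc).2 (Lp.memLp h)

theorem integrable_extendZero : Integrable (extendZero t h) :=
  integrable_of_memLp_two_of_support_subset (memLp_extendZero h) (support_extendZero_subset h)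

theorem eLpNorm_extendZero : eLpNorm (extendZero t h) 2 = ENNReal.ofReal ‖h‖ := by
  rw [extendZero, eLpNorm_indicator_eq_eLpNorm_restrict measurableSet_Icc, Lp.norm_def,
    ENNReal.ofReal_toReal (Lp.eLpNorm_ne_top h)]

theorem extendZero_ae_eq {g : ℝ → ℂ} (hg : h =ᵐ[volume.restrict (Icc (-t) t)] g) :
    extendZero t h =ᵐ[volume] (Icc (-t) t).indicator g := by
  filter_upwards [(ae_restrict_iff' measurableSet_Icc).1 hg] with x hx
  by_cases hxt : x ∈ Icc (-t) t
  · rw [extendZero, indicator_of_mem hxt, indicator_of_mem hxt, hx hxt]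
  · rw [extendZero, indicator_of_notMem hxt, indicator_of_notMem hxt]

theorem fourierT_extendZero_add (x : ℝ) : fourierT (extendZero t (h + h')) x =
    fourierT (extendZero t h) x + fourierT (extendZero t h') x := by
  rw [← fourierT_add (integrable_extendZero h) (integrable_extendZero h')]
  refine fourierT_congr_ae ((extendZero_ae_eq _ (Lp.coeFn_add h h')).trans (.of_eq ?_)) _
  exact indicator_add' _ _ _

theorem fourierT_extendZero_smul (c : ℂ) (x : ℝ) : fourierT (extendZero t (c • h)) x =
    c * fourierT (extendZero t h) x := by
  rw [← fourierT_const_smul]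
  refine fourierT_congr_ae ((extendZero_ae_eq _ (Lp.coeFn_smul c h)).trans (.of_eq ?_)) _
  exact indicator_const_smul (Icc (-t) t) c (h : ℝ → ℂ)

end extendZero

/-- Evaluation of the Fourier transform at a real point, on `L²[-t, t]`. -/
noncomputable def evalFourierT (t x : ℝ) :
    Lp ℂ 2 (volume.restrict (Icc (-t) t)) →L[ℂ] ℂ :=
  LinearMap.mkContinuous
    { toFun := fun h => fourierT (extendZero t h) x
      map_add' := fun h h' => fourierT_extendZero_add h h' x
      map_smul' := fun c h => fourierT_extendZero_smul h c x }
    ((ENNReal.ofReal (2 * t) ^ (1 / 2 : ℝ)).toReal) fun h => by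
      have := enorm_fourierT_le (memLp_extendZero h) (support_extendZero_subset h) x
      rw [eLpNorm_extendZero] at this
      have h2 := ENNReal.toReal_mono (by finiteness) this
      rwa [toReal_enorm, ENNReal.toReal_mul, ENNReal.toReal_ofReal (norm_nonneg h)] at h2

/-- The Fourier transform as an operator from `L²[-t, t]` to `L²(μ)`, for `μ` satisfying the upper
sampling inequality. -/
noncomputable def fourierTOperator {μ : Measure ℝ} {t B : ℝ} (hB : 0 < B)
    (hμ : ∀ g : ℝ → ℂ, MemLp g 2 → Function.support g ⊆ Icc (-t) t →
      normL2 μ (fourierT g) ≤ ENNReal.ofReal B * eLpNorm g 2) :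
    Lp ℂ 2 (volume.restrict (Icc (-t) t)) →L[ℂ] Lp ℂ 2 μ :=
  have hb : ∀ h : Lp ℂ 2 (volume.restrict (Icc (-t) t)),
      normL2 μ (fourierT (extendZero t h)) ≤ ENNReal.ofReal B * ENNReal.ofReal ‖h‖ := fun h =>
    (hμ _ (memLp_extendZero h) (support_extendZero_subset h)).trans_eq
      (by rw [eLpNorm_extendZero])
  have hm : ∀ h : Lp ℂ 2 (volume.restrict (Icc (-t) t)),
      MemLp (fun x : ℝ => fourierT (extendZero t h) x) 2 μ := fun h =>
    ⟨(continuous_fourierT_ofReal (integrable_extendZero h)).aestronglyMeasurable,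
      (hb h).trans_lt (by finiteness)⟩
  LinearMap.mkContinuous
    { toFun := fun h => (hm h).toLp
      map_add' := fun h h' => by
        rw [← MemLp.toLp_add]
        exact MemLp.toLp_congr _ _ (.of_forall fun x => fourierT_extendZero_add h h' x)
      map_smul' := fun c h => by
        rw [RingHom.id_apply, ← MemLp.toLp_const_smul]
        exact MemLp.toLp_congr _ _ (.of_forall fun x => fourierT_extendZero_smul h c x) }
    B fun h => by
      change ‖(hm h).toLp‖ ≤ _
      rw [Lp.norm_toLp, ← ENNReal.toReal_ofReal (by positivity : 0 ≤ B * ‖h‖),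
        ENNReal.ofReal_mul hB.le]
      exact ENNReal.toReal_mono (by finiteness) (hb h)

theorem ofReal_norm_fourierTOperator {μ : Measure ℝ} {t B : ℝ} (hB : 0 < B)
    (hμ : ∀ g : ℝ → ℂ, MemLp g 2 → Function.support g ⊆ Icc (-t) t →
      normL2 μ (fourierT g) ≤ ENNReal.ofReal B * eLpNorm g 2)
    (h : Lp ℂ 2 (volume.restrict (Icc (-t) t))) :
    ENNReal.ofReal ‖fourierTOperator hB hμ h‖ = normL2 μ (fourierT (extendZero t h)) := by
  have hm : MemLp (fun x : ℝ => fourierT (extendZero t h) x) 2 μ :=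
    ⟨(continuous_fourierT_ofReal (integrable_extendZero h)).aestronglyMeasurable,
      (hμ _ (memLp_extendZero h) (support_extendZero_subset h)).trans_lt
        (ENNReal.mul_lt_top (by finiteness) (memLp_extendZero h).eLpNorm_lt_top)⟩
  change ENNReal.ofReal ‖hm.toLp‖ = _
  rw [Lp.norm_toLp, ENNReal.ofReal_toReal hm.eLpNorm_ne_top, normL2]

/-! ### Injectivity and the sampling inequalities -/

/-- An entire function vanishing in `L²(μ)` vanishes identically if `μ` is not discrete. -/
theorem eq_zero_of_normL2_eq_zero {μ : Measure ℝ} (hμ : ¬ IsDiscreteMeasure μ) {F : ℂ → ℂ}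
    (hF : Differentiable ℂ F) (h0 : normL2 μ F = 0) : F = 0 := by
  have hcont : Continuous fun x : ℝ => F x := hF.continuous.comp Complex.continuous_ofReal
  rw [normL2, eLpNorm_eq_zero_iff hcont.aestronglyMeasurable two_ne_zero] at h0
  -- The zero set is closed and of full measure, so it contains the support.
  have hsupp : ∀ x ∈ μ.support, F x = 0 := by
    have hclosed : IsClosed {x : ℝ | F x = 0} := isClosed_eq hcont continuous_const
    exact fun x hx => Measure.support_subset_of_isClosed hclosed h0 hx
  simp only [IsDiscreteMeasure, not_forall, not_not] at hμ
  obtain ⟨x, hx⟩ := hμ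
  have hfreq : ∃ᶠ z in 𝓝[≠] (x : ℂ), F z = 0 := by
    have h1 : ∃ᶠ y : ℝ in 𝓝[≠] x, F (y : ℂ) = 0 :=
      (accPt_iff_frequently_nhdsNE.1 hx).mono fun y hy => hsupp y hy
    have h2 : Tendsto (fun y : ℝ => (y : ℂ)) (𝓝[≠] x) (𝓝[≠] (x : ℂ)) :=
      tendsto_nhdsWithin_of_tendsto_nhds_of_eventually_within _
        (Complex.continuous_ofReal.continuousAt.tendsto.mono_left nhdsWithin_le_nhds)
        (eventually_mem_nhdsWithin.mono fun y hy => by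
          simpa using hy)
    exact h2.frequently h1
  have han : AnalyticOnNhd ℂ F univ := fun z _ => hF.analyticAt z
  funext z
  exact han.eqOn_zero_of_preconnected_of_frequently_eq_zero isPreconnected_univ (mem_univ _) hfreq
    (mem_univ z)

/-- Here f = 0, so the empty trigonometric polynomial suffices and no evaluations remain. -/
theorem exists_le_normL2_volume {t : ℝ} (ht : 0 < t) :
    ∃ k : ℝ, 0 < k ∧ ∀ g : ℝ → ℂ, MemLp g 2 → Function.support g ⊆ Icc (-t) t →
      ENNReal.ofReal k * eLpNorm g 2 ≤ normL2 volume (fourierT g) := by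
  refine ⟨Real.sqrt (Real.sqrt (2 * Real.pi) / 2 / Real.sqrt (2 * Real.pi)), by positivity,
    fun g hg hs => ?_⟩
  have := fourierEqDeltaAdd_volume.le_normL2_add_sum isPoissonFinite_volume (by positivity)
    (MeasureTheory.locallyIntegrable_zero) ht (s := (∅ : Finset ℕ)) (c := 0) (l := 0)
    (by simp; positivity) hg hs
  simpa using this

theorem IsGLMeasure.exists_le_normL2 {μ : Measure ℝ} (hμ : IsGLMeasure μ) {t : ℝ} (ht : 0 < t) :
    ∃ k : ℝ, 0 < k ∧ ∀ g : ℝ → ℂ, MemLp g 2 → Function.support g ⊆ Icc (-t) t →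
      ENNReal.ofReal k * eLpNorm g 2 ≤ normL2 μ (fourierT g) := by
  obtain ⟨C, hC, f, hf, hF⟩ := hμ.fourier_eq
  obtain ⟨s, c, l, happ⟩ := exists_trigPoly_integral_norm_sub_le hf (2 * (2 * t)) (half_pos hC)
  obtain ⟨B, hB, hBg⟩ := hF.normL2_le hμ.poissonFinite hC hf ht
  obtain ⟨kv, hkv, hkvg⟩ := exists_le_normL2_volume ht
  set S := fourierTOperator hB hBg with hS
  set L : Lp ℂ 2 (volume.restrict (Icc (-t) t)) →L[ℂ] (s → ℂ) :=
    ContinuousLinearMap.pi fun i => evalFourierT t (l i) with hL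
  set a : ℤ → ℝ := fun n => Real.sqrt (Real.sqrt (2 * Real.pi) * ‖c n‖) with ha
  have ha0 : ∀ n, 0 ≤ a n := fun n => Real.sqrt_nonneg _
  -- The entire function ĥ vanishes identically, and the lower bound for Lebesgue measure then gives
  -- h = 0.
  have hinj : ∀ h, S h = 0 → h = 0 := by
    intro h hh
    have h1 := ofReal_norm_fourierTOperator hB hBg h
    rw [← hS, hh, norm_zero, ENNReal.ofReal_zero] at h1
    have h2 := eq_zero_of_normL2_eq_zero hμ.not_discrete
      (differentiable_fourierT (integrable_extendZero h) (support_extendZero_subset h)) h1.symm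
    have h3 := hkvg _ (memLp_extendZero h) (support_extendZero_subset h)
    rw [h2, eLpNorm_extendZero, ← ENNReal.ofReal_mul hkv.le] at h3
    simp only [normL2, Pi.zero_apply, eLpNorm_zero', nonpos_iff_eq_zero,
      ENNReal.ofReal_eq_zero] at h3
    exact norm_le_zero_iff.1 (by nlinarith)
  set k := Real.sqrt (C / 2 / Real.sqrt (2 * Real.pi)) with hk
  have hk0 : 0 < k := by positivity
  obtain ⟨c', hc', hle⟩ := S.exists_le_norm_of_finiteDimensional L hinj hk0
    -- Each evaluation is at most the sup norm of `L h`, so the weights add up to M.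
    (M := ∑ n ∈ s, a n) (Finset.sum_nonneg fun n _ => ha0 n) fun h => by
      have h1 := hF.le_normL2_add_sum hμ.poissonFinite hC hf ht happ (memLp_extendZero h)
        (support_extendZero_subset h)
      rw [← ofReal_norm_fourierTOperator hB hBg, eLpNorm_extendZero,
        ← ENNReal.ofReal_mul (Real.sqrt_nonneg _)] at h1
      have h2 : ∑ n ∈ s, ENNReal.ofReal (a n) * ‖fourierT (extendZero t h) (l n)‖ₑ =
          ENNReal.ofReal (∑ n ∈ s, a n * ‖fourierT (extendZero t h) (l n)‖) := by
        rw [ENNReal.ofReal_sum_of_nonneg fun n _ => mul_nonneg (ha0 n) (norm_nonneg _)]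
        refine Finset.sum_congr rfl fun n _ => ?_
        rw [← ofReal_norm, ← ENNReal.ofReal_mul (ha0 n)]
      have hnn : 0 ≤ ∑ n ∈ s, a n * ‖fourierT (extendZero t h) (l n)‖ :=
        Finset.sum_nonneg fun n _ => mul_nonneg (ha0 n) (norm_nonneg _)
      rw [h2, ← ENNReal.ofReal_add (norm_nonneg _) hnn, ENNReal.ofReal_le_ofReal_iff
        (add_nonneg (norm_nonneg _) hnn)] at h1
      refine h1.trans (add_le_add le_rfl ?_)
      rw [Finset.sum_mul]
      refine Finset.sum_le_sum fun n hn => mul_le_mul_of_nonneg_left ?_ (ha0 n)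
      exact norm_le_pi_norm (L h) ⟨n, hn⟩
  refine ⟨c', hc', fun g hg hs => ?_⟩
  have hgr : MemLp g 2 (volume.restrict (Icc (-t) t)) := hg.restrict _
  have hae : extendZero t hgr.toLp =ᵐ[volume] g :=
    (extendZero_ae_eq _ hgr.coeFn_toLp).trans (.of_eq (indicator_eq_self.2 hs))
  have hT : fourierT (extendZero t hgr.toLp) = fourierT g := funext (fourierT_congr_ae hae)
  rw [← hT, ← eLpNorm_congr_ae hae, eLpNorm_extendZero, ← ENNReal.ofReal_mul hc'.le,
    ← ofReal_norm_fourierTOperator hB hBg]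
  exact ENNReal.ofReal_le_ofReal (hle _)

/-- Eliminates ‖g‖ (here y) between an upper bound for one measure and a lower bound for the other;
it serves both sampling inequalities with μ and Lebesgue measure interchanged. -/
theorem ofReal_inv_mul_le_of_le {b k C : ℝ} (hb : 0 < b) (hk : 0 < k) (hC : b / k ≤ C)
    {x y z : ℝ≥0∞} (hx : x ≤ ENNReal.ofReal b * y) (hy : ENNReal.ofReal k * y ≤ z) :
    x ≤ ENNReal.ofReal C * z :=
  calc x ≤ ENNReal.ofReal b * y := hx
    _ = ENNReal.ofReal (b / k) * (ENNReal.ofReal k * y) := by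
      rw [← mul_assoc, ← ENNReal.ofReal_mul (by positivity), div_mul_cancel₀ _ hk.ne']
    _ ≤ _ := mul_le_mul' (ENNReal.ofReal_le_ofReal hC) hy

theorem mainTheorem6 (μ : MeasureTheory.Measure ℝ) (hμ : IsGLMeasure μ) : IsPWSampling μ := by
  intro t ht
  obtain ⟨C, hC, f, hf, hF⟩ := hμ.fourier_eq
  obtain ⟨b, hb, hbg⟩ := hF.normL2_le hμ.poissonFinite hC hf ht
  obtain ⟨bv, hbv, hbvg⟩ := fourierEqDeltaAdd_volume.normL2_le isPoissonFinite_volume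
    (by positivity) locallyIntegrable_zero ht
  obtain ⟨k, hk, hkg⟩ := hμ.exists_le_normL2 ht
  obtain ⟨kv, hkv, hkvg⟩ := exists_le_normL2_volume ht
  have hK : 0 < max (b / kv) (bv / k) := lt_max_of_lt_left (by positivity)
  refine ⟨_, hK, ?_⟩
  rintro F ⟨g, hg, hs, hFg⟩
  obtain rfl : F = fourierT g := funext hFg
  refine ⟨?_, ofReal_inv_mul_le_of_le hb hkv (le_max_left _ _) (hbg g hg hs) (hkvg g hg hs)⟩
  rw [ENNReal.ofReal_inv_of_pos hK,
    ENNReal.inv_mul_le_iff (ENNReal.ofReal_pos.2 hK).ne' ENNReal.ofReal_ne_top]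
  exact ofReal_inv_mul_le_of_le hbv hk (le_max_right _ _) (hbvg g hg hs) (hkg g hg hs)
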